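/- For $\varepsilon>0$ consider the ABC flow with $A=\varepsilon$, $B=C=1$, that is, the system $$x'=\cos y+\varepsilon\sin z,\qquad y'=\sin x+\varepsilon\cos z,\qquad z'=\cos x+\sin y$$ in $\mathbb R^3$; a trajectory is a solution $X=(x,y,z):\mathbb R\to\mathbb R^3$ defined for all times $t\in\mathbb R$. There is $\varepsilon_0>0$ such that for every $\varepsilon\in(0,\varepsilon_0)$ the following hold. (a) There exist $T>0$ and four trajectories $X_1,X_2,X_3,X_4$ such that for all $t\in\mathbb R$ $$X_1(t+T)=X_1(t)+(2\pi,2\pi,0),\qquad X_2(t+T)=X_2(t)-(2\pi,2\pi,0),$$ $$X_3(t+T)=X_3(t)+(2\pi,-2\pi,0),\qquad X_4(t+T)=X_4(t)-(2\pi,-2\pi,0).$$ (b) There exist $T>0$ and four trajectories $X_1,X_2,X_3,X_4$ such that for all $t\in\mathbb R$ $$X_1(t+T)=X_1(t)+(2\pi,0,0),\qquad X_2(t+T)=X_2(t)-(2\pi,0,0),$$ $$X_3(t+T)=X_3(t)+(0,2\pi,0),\qquad X_4(t+T)=X_4(t)-(0,2\pi,0).$$ -/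

import Mathlib

/-- The Arnold-Beltrami-Childress vector field on `ℝ³` with real parameters `A`, `B`, `C`;
the coordinates of `p` are `x = p 0`, `y = p 1`, `z = p 2`. -/
noncomputable def abcField (A B C : ℝ) (p : Fin 3 → ℝ) : Fin 3 → ℝ :=
  ![A * Real.sin (p 2) + C * Real.cos (p 1),
    B * Real.sin (p 0) + A * Real.cos (p 2),
    C * Real.sin (p 1) + B * Real.cos (p 0)]

/-- `X : ℝ → ℝ³` is a trajectory of the ABC flow: it solves `X' = abcField A B C X`
at every time `t ∈ ℝ`. -/
def IsABCTrajectory (A B C : ℝ) (X : ℝ → Fin 3 → ℝ) : Prop :=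
  ∀ t : ℝ, HasDerivAt X (abcField A B C (X t)) t

/-! For `ε = 0` the quantity `z' = cos x + sin y` is a first integral of the planar system in `(x,
y)`, and on its zero level, a network of saddle connections, `z` is constant. In coordinates `U`,
`V` along the connections the integral is a multiple of `sin U * sin V`. For small `ε > 0` the
integral drifts at rate `O(ε)`, so `z` moves by at most `1/4` during a time `T` with `16 ε T² = 1`.
Near suitable levels of `z` the perturbation pushes the orbit to a fixed side of the saddle, and the
orbit turns the corner in time `O(log (1/ε))`, well within `T`.

Closed drifting orbits then come from time-reversing symmetries. A trajectory meeting the fixed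
lines of two such symmetries, a time `τ` apart, is invariant under their composite, a time shift by
`2τ` combined with an isometry whose square is a translation. Orbits are started on one fixed line,
parametrized by the height `z`. Shooting in this parameter yields one that meets the second line:
the first crossing time is continuous by transversality, and the bounded change of `z` gives
opposite signs at the two end heights (`exists_common_zero_of_crossing`). The corner itself is
controlled by `SaddlePassage.V_bounds` and `SaddlePassage.exists_pi_div_two_le_U`. Time-preserving
symmetries supply the other directions. -/

/-! ### Global flow of a bounded Lipschitz field. -/

/-- Two solutions of an autonomous Lipschitz equation separate at most exponentially,
in both time directions. -/
theorem dist_le_mul_exp_of_hasDerivAt {E : Type*} [NormedAddCommGroup E] [NormedSpace ℝ E]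
    {f : E → E} {K : NNReal} (hf : LipschitzWith K f) {γ δ : ℝ → E}
    (hγ : ∀ t, HasDerivAt γ (f (γ t)) t) (hδ : ∀ t, HasDerivAt δ (f (δ t)) t) (t : ℝ) :
    dist (γ t) (δ t) ≤ dist (γ 0) (δ 0) * Real.exp (K * |t|) := by
  have key : ∀ {g : E → E} {α β : ℝ → E}, LipschitzWith K g →
      (∀ t, HasDerivAt α (g (α t)) t) → (∀ t, HasDerivAt β (g (β t)) t) → ∀ s, 0 ≤ s →
      dist (α s) (β s) ≤ dist (α 0) (β 0) * Real.exp (K * s) := by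
    intro g α β hg hα hβ s hs
    have := dist_le_of_trajectories_ODE (v := fun _ => g) (a := 0) (b := s) (fun _ => hg)
      (fun t _ => (hα t).continuousAt.continuousWithinAt) (fun t _ => (hα t).hasDerivWithinAt)
      (fun t _ => (hβ t).continuousAt.continuousWithinAt) (fun t _ => (hβ t).hasDerivWithinAt)
      le_rfl s ⟨hs, le_rfl⟩
    simpa using this
  rcases le_total 0 t with ht | ht
  · rw [abs_of_nonneg ht]
    exact key hf hγ hδ t ht
  · have hrev : ∀ {α : ℝ → E}, (∀ t, HasDerivAt α (f (α t)) t) →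
        ∀ t, HasDerivAt (fun s => α (-s)) (-f (α (-t))) t := by
      intro α hα t
      simpa [Function.comp_def] using (hα (-t)).scomp t (hasDerivAt_neg t)
    have := key (g := fun x => -f x) hf.neg (hrev hγ) (hrev hδ) (-t) (by linarith)
    rw [abs_of_nonpos ht]
    simpa using this

/-- A bounded Lipschitz vector field has a global, jointly continuous flow. -/
theorem exists_continuous_flow {E : Type*} [NormedAddCommGroup E] [NormedSpace ℝ E]
    [CompleteSpace E] {f : E → E} {K L : NNReal} (hf : LipschitzWith K f)
    (hL : ∀ x, ‖f x‖ ≤ L) :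
    ∃ Φ : E → ℝ → E, (∀ x, Φ x 0 = x) ∧ (∀ x t, HasDerivAt (Φ x) (f (Φ x t)) t) ∧
      Continuous fun p : E × ℝ => Φ p.1 p.2 := by
  have hloc : ∀ (x : E) (N : ℝ), 0 < N → ∃ γ : ℝ → E, γ 0 = x ∧
      ∀ t ∈ Set.Ioo (-N) N, HasDerivAt γ (f (γ t)) t := by
    intro x N hN
    -- Speed at most `L` keeps the solution in the ball of radius `L * N` up to time `N`, so no
    -- smallness of `N` is needed.
    have hpl : IsPicardLindelof (fun _ => f) (tmin := -N) (tmax := N)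
        ⟨0, by constructor <;> linarith⟩ x (L * N.toNNReal) 0 L K :=
      { lipschitzOnWith := fun t _ => hf.lipschitzOnWith
        continuousOn := fun x _ => continuousOn_const
        norm_le := fun t _ x _ => hL x
        mul_max_le := by simp [hN.le] }
    obtain ⟨γ, h0, h⟩ := hpl.exists_eq_forall_mem_Icc_hasDerivWithinAt₀
    exact ⟨γ, h0, fun t ht =>
      (h t (Set.Ioo_subset_Icc_self ht)).hasDerivAt (Icc_mem_nhds ht.1 ht.2)⟩
  have hpos : ∀ t : ℝ, 0 < |t| + 1 := fun t => by positivity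
  choose γ hγ0 hγ using hloc
  -- The solution used at time `t` lives on an interval that depends on `t`; uniqueness (`hagree`)
  -- glues these choices together.
  let Φ : E → ℝ → E := fun x t => γ x (|t| + 1) (hpos t) t
  have hagree : ∀ x N (hN : 0 < N), ∀ t ∈ Set.Ioo (-N) N, Φ x t = γ x N hN t := by
    intro x N hN t ht
    have hlt : |t| < N := abs_lt.2 ht
    set M := min (|t| + 1) N with hM
    have hM0 : 0 < M := lt_min (hpos t) hN
    have htM : t ∈ Set.Ioo (-M) M := abs_lt.1 (lt_min (by linarith) hlt)
    refine ODE_solution_unique_of_mem_Ioo (v := fun _ => f) (s := fun _ => Set.univ) (K := K)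
      (a := -M) (b := M) (t₀ := 0) (fun _ _ => hf.lipschitzOnWith) ⟨by linarith, hM0⟩
      (fun s hs => ⟨hγ x _ _ s ?_, trivial⟩) (fun s hs => ⟨hγ x _ _ s ?_, trivial⟩) ?_ htM
    · exact abs_lt.1 ((abs_lt.2 hs).trans_le (min_le_left _ _))
    · exact abs_lt.1 ((abs_lt.2 hs).trans_le (min_le_right _ _))
    · rw [hγ0, hγ0]
  have hder : ∀ x t, HasDerivAt (Φ x) (f (Φ x t)) t := by
    intro x t
    have ht : t ∈ Set.Ioo (-(|t| + 1)) (|t| + 1) := abs_lt.1 (by linarith)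
    refine (hγ x _ (hpos t) t ht).congr_of_eventuallyEq ?_
    filter_upwards [Ioo_mem_nhds ht.1 ht.2] with s hs using hagree x _ _ s hs
  have h0 : ∀ x, Φ x 0 = x := fun x => hγ0 _ _ _
  refine ⟨Φ, h0, hder, continuous_iff_continuousAt.2 fun ⟨x, t⟩ => ?_⟩
  have hsq : Filter.Tendsto (fun p : E × ℝ => dist p.1 x * Real.exp (K * |p.2|) +
      dist (Φ x p.2) (Φ x t)) (nhds (x, t)) (nhds 0) := by
    have hc : ContinuousAt (fun p : E × ℝ => dist p.1 x * Real.exp (K * |p.2|) +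
        dist (Φ x p.2) (Φ x t)) (x, t) := by
      have h1 : ContinuousAt (fun p : E × ℝ => Φ x p.2) (x, t) :=
        ContinuousAt.comp (f := Prod.snd) (g := Φ x) (hder x t).continuousAt continuousAt_snd
      exact ContinuousAt.add (by fun_prop) (h1.dist continuousAt_const)
    simpa [ContinuousAt] using hc
  refine tendsto_iff_dist_tendsto_zero.2 (squeeze_zero (fun _ => dist_nonneg) (fun p => ?_) hsq)
  refine (dist_triangle _ (Φ x p.2) _).trans (add_le_add ?_ le_rfl)
  simpa [h0] using dist_le_mul_exp_of_hasDerivAt hf (hder p.1) (hder x) p.2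

/-! ### First crossing times, shooting and barriers. -/

/-- If `u (·, p)` is negative up to time `τ p`, vanishes there and then becomes positive at
arbitrarily close later times, then the crossing time `τ` depends continuously on `p`. -/
theorem continuousOn_crossing_time {S : Set ℝ} {u : ℝ → ℝ → ℝ} {τ : ℝ → ℝ}
    (hu : Continuous fun q : ℝ × ℝ => u q.1 q.2) (hτ : ∀ p ∈ S, 0 ≤ τ p)
    (hneg : ∀ p ∈ S, ∀ t, 0 ≤ t → t < τ p → u p t < 0)
    (hzero : ∀ p ∈ S, u p (τ p) = 0)
    (hpos : ∀ p ∈ S, ∀ η > 0, ∃ t, τ p < t ∧ t < τ p + η ∧ 0 < u p t) :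
    ContinuousOn τ S := by
  intro p hp
  rw [ContinuousWithinAt, tendsto_order]
  constructor
  · intro a ha
    have hev : ∀ᶠ q in nhds p, ∀ t ∈ Set.Icc 0 a, u q t < 0 := by
      refine isCompact_Icc.eventually_forall_of_forall_eventually fun t ht => ?_
      exact hu.continuousAt.eventually_lt continuousAt_const
        (hneg p hp t ht.1 (ht.2.trans_lt ha))
    filter_upwards [nhdsWithin_le_nhds hev, self_mem_nhdsWithin] with q hq hqS
    by_contra! hle
    exact (hq (τ q) ⟨hτ q hqS, hle⟩).ne (hzero q hqS)
  · intro b hb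
    obtain ⟨t, ht1, ht2, ht3⟩ := hpos p hp (b - τ p) (by linarith)
    have hev : ∀ᶠ q in nhds p, 0 < u q t := by
      have : Continuous fun q => u q t := hu.comp (by fun_prop : Continuous fun q : ℝ => (q, t))
      exact continuousAt_const.eventually_lt this.continuousAt ht3
    filter_upwards [nhdsWithin_le_nhds hev, self_mem_nhdsWithin] with q hq hqS
    by_contra! hle
    exact absurd (hneg q hqS t ((hτ p hp).trans ht1.le) (by linarith)) (by linarith)

/-- A continuous function that starts below `c` and reaches `c` has a first hitting time. -/
theorem exists_first_hitting_time {f : ℝ → ℝ} {c t : ℝ} (hf : Continuous f) (h0 : f 0 < c)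
    (ht : 0 ≤ t) (hft : c ≤ f t) :
    ∃ s, 0 < s ∧ s ≤ t ∧ f s = c ∧ ∀ r, 0 ≤ r → r < s → f r < c := by
  obtain ⟨s, ⟨⟨hs0, hst⟩, hsc⟩, hmin⟩ := (isCompact_Icc.inter_right
    (isClosed_singleton.preimage hf : IsClosed (f ⁻¹' {c}))).exists_isLeast
    (s := Set.Icc 0 t ∩ f ⁻¹' {c}) (by
      obtain ⟨r, hr, hrc⟩ := intermediate_value_Icc ht hf.continuousOn ⟨h0.le, hft⟩
      exact ⟨r, hr, hrc⟩)
  have hsc' : f s = c := hsc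
  refine ⟨s, hs0.lt_of_ne ?_, hst, hsc, fun r hr hrs => ?_⟩
  · rintro rfl
    exact h0.ne hsc
  · by_contra! hle
    obtain ⟨q, hq, hqc⟩ := intermediate_value_Icc hr hf.continuousOn ⟨h0.le, hle⟩
    have := hmin ⟨⟨hq.1, hq.2.trans (hrs.le.trans hst)⟩, hqc⟩
    linarith [hq.2]

/-- Shooting: in a one-parameter family, if `u` crosses zero transversally at its first zero and
`g` has opposite signs at the ends of the parameter interval, then some member of the family has
`u` and `g` vanishing simultaneously. -/
theorem exists_common_zero_of_crossing {a b T : ℝ} (hab : a ≤ b) {u g : ℝ → ℝ → ℝ}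
    (hu : Continuous fun q : ℝ × ℝ => u q.1 q.2) (hg : Continuous fun q : ℝ × ℝ => g q.1 q.2)
    (h0 : ∀ p ∈ Set.Icc a b, u p 0 < 0)
    (hT : ∀ p ∈ Set.Icc a b, ∃ t ∈ Set.Icc 0 T, 0 ≤ u p t)
    (hd : ∀ p ∈ Set.Icc a b, ∀ t ∈ Set.Icc 0 T, u p t = 0 → (∀ s ∈ Set.Icc 0 t, u p s ≤ 0) →
      ∃ d > 0, HasDerivAt (u p) d t)
    (ha : ∀ t ∈ Set.Icc 0 T, g a t ≤ 0) (hb : ∀ t ∈ Set.Icc 0 T, 0 ≤ g b t) :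
    ∃ p, ∃ t > 0, u p t = 0 ∧ g p t = 0 := by
  have hup : ∀ p, Continuous (u p) := fun p =>
    hu.comp (by fun_prop : Continuous fun t : ℝ => (p, t))
  -- Membership is placed inside the existential so that `τ` becomes a total function; its value `0`
  -- off the interval plays no role.
  have hex : ∀ p, ∃ s, p ∈ Set.Icc a b →
      0 < s ∧ s ≤ T ∧ u p s = 0 ∧ ∀ r, 0 ≤ r → r < s → u p r < 0 := by
    intro p
    by_cases hp : p ∈ Set.Icc a b
    · obtain ⟨t, ht, hut⟩ := hT p hp
      obtain ⟨s, h1, h2, h3, h4⟩ := exists_first_hitting_time (hup p) (h0 p hp) ht.1 hut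
      exact ⟨s, fun _ => ⟨h1, h2.trans ht.2, h3, h4⟩⟩
    · exact ⟨0, fun h => absurd h hp⟩
  choose τ hτ using hex
  have hcont : ContinuousOn τ (Set.Icc a b) := by
    refine continuousOn_crossing_time hu (fun p hp => (hτ p hp).1.le)
      (fun p hp => (hτ p hp).2.2.2) (fun p hp => (hτ p hp).2.2.1) fun p hp η hη => ?_
    obtain ⟨h1, h2, h3, h4⟩ := hτ p hp
    obtain ⟨d, hd0, hder⟩ := hd p hp (τ p) ⟨h1.le, h2⟩ h3 fun s hs => by
      rcases hs.2.eq_or_lt with h | h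
      · rw [h, h3]
      · exact (h4 s hs.1 h).le
    have hev : ∀ᶠ t in nhdsWithin (τ p) (Set.Ioi (τ p)), 0 < slope (u p) (τ p) t :=
      ((hasDerivAt_iff_tendsto_slope.1 hder).mono_left
        (nhdsWithin_mono _ fun t ht => ne_of_gt ht)).eventually_const_lt hd0
    obtain ⟨t, hs, ht⟩ := (hev.and (Ioo_mem_nhdsGT (by linarith : τ p < τ p + η))).exists
    refine ⟨t, ht.1, ht.2, ?_⟩
    have := (slope_pos_iff ht.1).1 hs
    linarith
  have hgc : ContinuousOn (fun p => g p (τ p)) (Set.Icc a b) :=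
    hg.comp_continuousOn (continuousOn_id.prodMk hcont)
  have hmem : ∀ p ∈ Set.Icc a b, τ p ∈ Set.Icc 0 T := fun p hp => ⟨(hτ p hp).1.le, (hτ p hp).2.1⟩
  obtain ⟨p, hp, hgp⟩ := intermediate_value_Icc hab hgc
    ⟨ha _ (hmem a ⟨le_rfl, hab⟩), hb _ (hmem b ⟨hab, le_rfl⟩)⟩
  exact ⟨p, τ p, (hτ p hp).1, (hτ p hp).2.2.1, hgp⟩

/-- The comparison principle used for one-sided bounds: `f` cannot cross the barrier `B` upwards
if it is slower than `B` whenever they touch. -/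
theorem le_barrier {f f' B B' : ℝ → ℝ} {a b : ℝ} (hf : ∀ t, HasDerivAt f (f' t) t)
    (hB : ∀ t, HasDerivAt B (B' t) t) (h0 : f a ≤ B a)
    (h : ∀ t ∈ Set.Ico a b, f t = B t → f' t < B' t) : ∀ t ∈ Set.Icc a b, f t ≤ B t :=
  image_le_of_deriv_right_lt_deriv_boundary
    (fun t _ => (hf t).continuousAt.continuousWithinAt) (fun t _ => (hf t).hasDerivWithinAt)
    h0 hB h

/-! ### Estimates for the passage of a saddle. -/

/-- The ABC flow near a heteroclinic connection of the unperturbed flow, in rotated coordinates: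
`U` is the unstable and `V` the stable direction at the saddle, `w` is the deviation of `z`. -/
structure SaddlePassage (ε : ℝ) (a b U V w : ℝ → ℝ) : Prop where
  hasDerivAt_U : ∀ t, HasDerivAt U (Real.sin (U t) * Real.cos (V t) + ε * a t) t
  hasDerivAt_V : ∀ t, HasDerivAt V (-(Real.sin (V t) * Real.cos (U t)) + ε * b t) t
  hasDerivAt_w : ∀ t, HasDerivAt w (-2 * (Real.sin (U t) * Real.sin (V t))) t
  U_zero : U 0 = 0
  V_zero : V 0 = Real.pi / 2
  abs_a_le : ∀ t, |a t| ≤ 1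
  abs_b_le : ∀ t, |b t| ≤ 1
  abs_w_zero_le : |w 0| ≤ 1 / 4
  le_a : ∀ t, |w t| ≤ 1 / 2 → 1 / 8 ≤ a t

namespace SaddlePassage

variable {ε T : ℝ} {a b U V w : ℝ → ℝ}

/-- `sin U * sin V` is a first integral at `ε = 0` and vanishes initially; only the two perturbation
terms, each at most `ε`, contribute to its derivative. -/
theorem abs_sin_mul_sin_le (h : SaddlePassage ε a b U V w) (hε : 0 < ε) {t : ℝ} (ht : 0 ≤ t) :
    |Real.sin (U t) * Real.sin (V t)| ≤ 2 * ε * t := by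
  have hder : ∀ s, HasDerivAt (fun s => Real.sin (U s) * Real.sin (V s))
      (ε * (a s * (Real.cos (U s) * Real.sin (V s)) + b s * (Real.sin (U s) * Real.cos (V s)))) s :=
    fun s => ((h.hasDerivAt_U s).sin.mul (h.hasDerivAt_V s).sin).congr_deriv (by ring)
  have hbound : ∀ s ∈ Set.Ico (0 : ℝ) t, ‖ε * (a s * (Real.cos (U s) * Real.sin (V s)) +
      b s * (Real.sin (U s) * Real.cos (V s)))‖ ≤ 2 * ε := by
    intro s _
    have hm : ∀ {x y z : ℝ}, |x| ≤ 1 → |y| ≤ 1 → |z| ≤ 1 → |x * (y * z)| ≤ 1 := by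
      intro x y z hx hy hz
      rw [abs_mul, abs_mul]
      exact mul_le_one₀ hx (by positivity) (mul_le_one₀ hy (by positivity) hz)
    have h1 := hm (h.abs_a_le s) (Real.abs_cos_le_one (U s)) (Real.abs_sin_le_one (V s))
    have h2 := hm (h.abs_b_le s) (Real.abs_sin_le_one (U s)) (Real.abs_cos_le_one (V s))
    rw [Real.norm_eq_abs, abs_mul, abs_of_pos hε, mul_comm 2]
    exact mul_le_mul_of_nonneg_left ((abs_add_le _ _).trans (by linarith)) hε.le
  have := norm_image_sub_le_of_norm_deriv_le_segment' (fun s _ => (hder s).hasDerivWithinAt)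
    hbound t ⟨ht, le_rfl⟩
  simpa [h.U_zero] using this

/-- Integrating `|w'| ≤ 4 ε T` over a time at most `T` gives `4 ε T² = 1/4`; this is what fixes the
normalization of `T`. -/
theorem abs_sub_w_le (h : SaddlePassage ε a b U V w) (hε : 0 < ε) (hT : 16 * ε * T ^ 2 = 1)
    {t : ℝ} (ht : t ∈ Set.Icc 0 T) : |w t - w 0| ≤ 1 / 4 := by
  have hbound : ∀ s ∈ Set.Ico (0 : ℝ) t,
      ‖-2 * (Real.sin (U s) * Real.sin (V s))‖ ≤ 4 * ε * T := by
    intro s hs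
    have := h.abs_sin_mul_sin_le hε hs.1
    rw [Real.norm_eq_abs, abs_mul, abs_neg, abs_two]
    nlinarith [hs.2, ht.2]
  have := norm_image_sub_le_of_norm_deriv_le_segment'
    (fun s _ => (h.hasDerivAt_w s).hasDerivWithinAt) hbound t ⟨ht.1, le_rfl⟩
  rw [sub_zero, Real.norm_eq_abs] at this
  nlinarith [mul_le_mul_of_nonneg_left ht.2 (by nlinarith [ht.1, ht.2] : 0 ≤ 4 * ε * T)]

theorem le_a_of_mem (h : SaddlePassage ε a b U V w) (hε : 0 < ε) (hT : 16 * ε * T ^ 2 = 1)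
    {t : ℝ} (ht : t ∈ Set.Icc 0 T) : |w t| ≤ 1 / 2 ∧ 1 / 8 ≤ a t := by
  have h1 := abs_le.1 (h.abs_sub_w_le hε hT ht)
  have h2 := abs_le.1 h.abs_w_zero_le
  have hw : |w t| ≤ 1 / 2 := abs_le.2 ⟨by linarith, by linarith⟩
  exact ⟨hw, h.le_a t hw⟩

/-- If `|sin V| ≥ 1/√2` then `U` is still close to `0`, because `sin U * sin V` is small. -/
theorem half_le_cos_U (h : SaddlePassage ε a b U V w) (hε : 0 < ε) (hT : 16 * ε * T ^ 2 = 1)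
    (hT1 : 1 ≤ T) {t : ℝ} (ht : t ∈ Set.Icc 0 T) (hU0 : 0 ≤ U t) (hU : U t ≤ Real.pi / 2)
    (hV : 1 / 2 ≤ |Real.sin (V t)|) : 1 / 2 ≤ Real.cos (U t) := by
  have h1 := h.abs_sin_mul_sin_le hε ht.1
  have h2 : 0 ≤ Real.sin (U t) := Real.sin_nonneg_of_nonneg_of_le_pi hU0 (by linarith [Real.pi_pos])
  rw [abs_mul, abs_of_nonneg h2] at h1
  have h3 : 2 * ε * t ≤ 1 / 8 := by nlinarith [ht.2, mul_pos hε (by linarith : 0 < T)]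
  have h4 : Real.sin (U t) ≤ 1 / 4 := by nlinarith
  have h5 : 0 ≤ Real.cos (U t) := Real.cos_nonneg_of_neg_pi_div_two_le_of_le (by linarith) hU
  nlinarith [Real.sin_sq_add_cos_sq (U t)]

/-- On `U = 0` only the forcing `ε a > 0` remains, so `U` cannot become negative. -/
theorem U_nonneg (h : SaddlePassage ε a b U V w) (hε : 0 < ε) (hT : 16 * ε * T ^ 2 = 1)
    {t : ℝ} (ht : t ∈ Set.Icc 0 T) : 0 ≤ U t := by
  have := le_barrier (f := fun t => -U t) (B := fun _ => 0) (a := 0) (b := T)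
    (fun t => (h.hasDerivAt_U t).neg) (fun t => hasDerivAt_const t 0) (by simp [h.U_zero])
    (fun s hs h0 => by
      have hs0 : U s = 0 := neg_eq_zero.1 h0
      have := (h.le_a_of_mem hε hT ⟨hs.1, hs.2.le⟩).2
      rw [hs0, Real.sin_zero]
      nlinarith) t ht
  exact neg_nonpos.1 this

/-- While `π/4 ≤ |V| ≤ π/2`, the small first integral forces `cos U ≥ 1/2`, so the contraction of
`V` towards `0` beats the perturbation, which is at most `1/16`. -/
theorem V_bounds (h : SaddlePassage ε a b U V w) (hε : 0 < ε) (hT : 16 * ε * T ^ 2 = 1)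
    (hT1 : 1 ≤ T) {t₁ : ℝ} (ht₁ : t₁ ≤ T) (hU : ∀ t ∈ Set.Icc 0 t₁, U t ≤ Real.pi / 2) :
    ∀ t ∈ Set.Icc 0 t₁, -(Real.pi / 4) ≤ V t ∧ V t ≤ Real.pi / 2 ∧
      (2 * Real.pi ≤ t → V t ≤ Real.pi / 4) := by
  have hpi := Real.pi_pos
  have hε1 : ε ≤ 1 / 16 := by
    nlinarith [mul_nonneg hε.le (by nlinarith : (0 : ℝ) ≤ T ^ 2 - 1)]
  have hsqrt : (7 : ℝ) / 5 ≤ √2 := Real.le_sqrt_of_sq_le (by norm_num)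
  have hsin : ∀ x, Real.pi / 4 ≤ x → x ≤ Real.pi / 2 → 7 / 10 ≤ Real.sin x := by
    intro x h1 h2
    have := Real.sin_le_sin_of_le_of_le_pi_div_two (by linarith) h2 h1
    rw [Real.sin_pi_div_four] at this
    linarith
  have hslow : ∀ t ∈ Set.Icc 0 t₁, ∀ x, |x| ∈ Set.Icc (Real.pi / 4) (Real.pi / 2) → V t = x →
      |ε * b t| ≤ 1 / 16 ∧ 1 / 2 ≤ Real.cos (U t) := by
    rintro t ht x hx rfl
    have htT : t ∈ Set.Icc 0 T := ⟨ht.1, ht.2.trans ht₁⟩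
    have hs : |Real.sin (V t)| = Real.sin |V t| := by
      refine Real.abs_sin_eq_sin_abs_of_abs_le_pi ?_
      linarith [hx.2]
    refine ⟨?_, h.half_le_cos_U hε hT hT1 htT (h.U_nonneg hε hT htT) (hU t ht) ?_⟩
    · rw [abs_mul, abs_of_pos hε]
      nlinarith [h.abs_b_le t]
    · rw [hs]
      linarith [hsin _ hx.1 hx.2]
  have hfall : ∀ t ∈ Set.Icc 0 t₁, Real.pi / 4 ≤ V t → V t ≤ Real.pi / 2 →
      -(Real.sin (V t) * Real.cos (U t)) + ε * b t < -(1 / 8) := by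
    intro t ht h1 h2
    obtain ⟨h3, h4⟩ := hslow t ht (V t) (by rw [abs_of_nonneg (by linarith)]; exact ⟨h1, h2⟩) rfl
    nlinarith [hsin _ h1 h2, (abs_le.1 h3).2]
  have hlow : ∀ t ∈ Set.Icc 0 t₁, -(Real.pi / 4) ≤ V t := by
    intro t ht
    have := le_barrier (f := fun t => -V t) (B := fun _ => Real.pi / 4) (a := 0) (b := t₁)
      (fun t => (h.hasDerivAt_V t).neg) (fun t => hasDerivAt_const t _)
      (by rw [h.V_zero]; linarith) (fun s hs h0 => by
        have h0' : V s = -(Real.pi / 4) := by linarith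
        obtain ⟨h3, h4⟩ := hslow s ⟨hs.1, hs.2.le⟩ _
          (by rw [abs_neg, abs_of_pos (by positivity)]; constructor <;> linarith) h0'
        rw [h0', Real.sin_neg]
        nlinarith [hsin (Real.pi / 4) le_rfl (by linarith), (abs_le.1 h3).1]) t ht
    linarith
  -- At speed at least `1/8`, the descent from `π/2` to `π/4` takes at most time `2π`.
  have hup : ∀ t ∈ Set.Icc 0 (min t₁ (2 * Real.pi)), V t ≤ Real.pi / 2 - 1 / 8 * t :=
    le_barrier h.hasDerivAt_V
      (fun t => ((hasDerivAt_id t).const_mul (1 / 8 : ℝ)).const_sub (Real.pi / 2))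
      (by rw [h.V_zero]; simp) (fun s hs h0 => by
        have h1 := lt_min_iff.1 hs.2
        have := hfall s ⟨hs.1, h1.1.le⟩ (by simp at h0; linarith) (by simp at h0; linarith [hs.1])
        linarith)
  have hlate : ∀ t ∈ Set.Icc (2 * Real.pi) t₁, V t ≤ Real.pi / 4 := by
    intro t ht
    exact le_barrier (a := 2 * Real.pi) (b := t₁) (B := fun _ => Real.pi / 4) h.hasDerivAt_V
      (fun t => hasDerivAt_const t _)
      (by
        have := hup (2 * Real.pi) ⟨by positivity, le_min (ht.1.trans ht.2) le_rfl⟩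
        linarith)
      (fun s hs h0 => by
        have := hfall s ⟨by linarith [hs.1], hs.2.le⟩ h0.ge (by linarith)
        linarith) t ht
  intro t ht
  refine ⟨hlow t ht, ?_, fun h2 => hlate t ⟨h2, ht.2⟩⟩
  rcases le_total t (2 * Real.pi) with h2 | h2
  · linarith [hup t ⟨ht.1, le_min ht.2 h2⟩, ht.1]
  · linarith [hlate t ⟨h2, ht.2⟩]

/-- Once `|V| ≤ π/4`, the direction `U` expands exponentially, and the forcing `ε a` provides a seed
of order `ε`; staying below `π/2` up to time `T` would contradict `hexp`. -/
theorem exists_pi_div_two_le_U (h : SaddlePassage ε a b U V w) (hε : 0 < ε)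
    (hT : 16 * ε * T ^ 2 = 1) (hT1 : 2 * Real.pi ≤ T)
    (hexp : 16 * Real.pi * T ^ 2 + 1 < Real.exp ((T - 2 * Real.pi) / 4)) :
    ∃ t ∈ Set.Icc 0 T, Real.pi / 2 ≤ U t := by
  by_contra! hlt
  have hpi := Real.pi_gt_three
  have hV := h.V_bounds hε hT (by linarith) le_rfl fun t ht => (hlt t ht).le
  -- After time `2π`, `cos V ≥ 1/2`, `sin U ≥ U/2` and `a ≥ 1/8` give `U' ≥ (U + ε/2)/4`, hence `G`
  -- is nondecreasing.
  set G : ℝ → ℝ := fun t => (U t + ε / 2) * Real.exp (-(t / 4)) with hG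
  have hGd : ∀ t, HasDerivAt G ((Real.sin (U t) * Real.cos (V t) + ε * a t) *
      Real.exp (-(t / 4)) + (U t + ε / 2) * (Real.exp (-(t / 4)) * (-(1 / 4)))) t := by
    intro t
    exact ((h.hasDerivAt_U t).add_const _).mul (((hasDerivAt_id t).div_const 4).neg.exp)
  have hmono : MonotoneOn G (Set.Icc (2 * Real.pi) T) := by
    refine monotoneOn_of_deriv_nonneg (convex_Icc _ _)
      (fun t _ => (hGd t).continuousAt.continuousWithinAt)
      (fun t _ => (hGd t).differentiableAt.differentiableWithinAt) fun t ht => ?_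
    rw [interior_Icc] at ht
    have ht' : t ∈ Set.Icc 0 T := ⟨by linarith [ht.1], ht.2.le⟩
    obtain ⟨hV1, -, hV2⟩ := hV t ht'
    have hU0 := h.U_nonneg hε hT ht'
    have ha := (h.le_a_of_mem hε hT ht').2
    have hcos : 1 / 2 ≤ Real.cos (V t) := by
      rw [← Real.cos_abs, ← Real.cos_pi_div_three]
      exact Real.cos_le_cos_of_nonneg_of_le_pi (abs_nonneg _) (by linarith)
        (abs_le.2 ⟨by linarith, by linarith [hV2 ht.1.le]⟩)
    have hsin : U t / 2 ≤ Real.sin (U t) := by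
      have h1 := Real.mul_le_sin hU0 (hlt t ht').le
      have h2 : 1 / 2 ≤ 2 / Real.pi := by
        rw [div_le_div_iff₀ two_pos (by linarith)]
        linarith [Real.pi_le_four]
      nlinarith
    rw [(hGd t).deriv]
    have : 0 ≤ (Real.sin (U t) * Real.cos (V t) + ε * a t - (U t + ε / 2) / 4) := by nlinarith
    nlinarith [mul_nonneg this (Real.exp_pos (-(t / 4))).le]
  have hTT : T ∈ Set.Icc 0 T := ⟨by linarith, le_rfl⟩
  have hfin := hmono ⟨le_rfl, hT1⟩ ⟨hT1, le_rfl⟩ hT1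
  have hstart := h.U_nonneg hε hT (t := 2 * Real.pi) ⟨by linarith, hT1⟩
  have hexp2 : Real.exp (-(2 * Real.pi / 4)) =
      Real.exp ((T - 2 * Real.pi) / 4) * Real.exp (-(T / 4)) := by
    rw [← Real.exp_add]
    congr 1
    ring
  simp only [hG] at hfin
  rw [hexp2, ← mul_assoc] at hfin
  have := le_of_mul_le_mul_right hfin (Real.exp_pos _)
  have hUT := hlt T hTT
  -- Multiplied by `2/ε` and with `1/ε = 16 T²`, this reads `exp ((T - 2π)/4) < 16 π T² + 1`,
  -- contrary to `hexp`.
  have h1 : ε / 2 * Real.exp ((T - 2 * Real.pi) / 4) < Real.pi / 2 + ε / 2 := by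
    nlinarith [mul_nonneg hstart (Real.exp_pos ((T - 2 * Real.pi) / 4)).le]
  nlinarith

end SaddlePassage

/-! ### Shooting through the saddle. -/

/-- In a family of saddle passages whose initial deviation sweeps `[-1/4, 1/4]`, some member
reaches the end `U = π / 2` of the unstable connection with zero deviation. -/
theorem SaddlePassage.exists_U_eq_pi_div_two {ε T : ℝ} {a b U V w : ℝ → ℝ → ℝ}
    (h : ∀ p ∈ Set.Icc (-(1 / 4) : ℝ) (1 / 4), SaddlePassage ε (a p) (b p) (U p) (V p) (w p))
    (hU : Continuous fun q : ℝ × ℝ => U q.1 q.2) (hw : Continuous fun q : ℝ × ℝ => w q.1 q.2)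
    (hw0 : ∀ p, w p 0 = p) (hε : 0 < ε) (hT : 16 * ε * T ^ 2 = 1) (hT1 : 2 * Real.pi ≤ T)
    (hexp : 16 * Real.pi * T ^ 2 + 1 < Real.exp ((T - 2 * Real.pi) / 4)) :
    ∃ p, ∃ t > 0, U p t = Real.pi / 2 ∧ w p t = 0 := by
  have hpi := Real.pi_gt_three
  obtain ⟨p, t, ht, h1, h2⟩ := exists_common_zero_of_crossing (a := -(1 / 4)) (b := 1 / 4) (T := T)
    (u := fun p t => U p t - Real.pi / 2) (g := w) (by norm_num) (by fun_prop) hw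
    (fun p hp => by rw [(h p hp).U_zero]; linarith)
    (fun p hp => by
      obtain ⟨t, ht, hUt⟩ := (h p hp).exists_pi_div_two_le_U hε hT hT1 hexp
      exact ⟨t, ht, by linarith⟩)
    (fun p hp t ht hut hle => by
      have hs := h p hp
      obtain ⟨hV1, hV2, -⟩ := hs.V_bounds hε hT (by linarith) ht.2
        (fun s hs => by linarith [hle s hs]) t ⟨ht.1, le_rfl⟩
      have hcos : 0 ≤ Real.cos (V p t) :=
        Real.cos_nonneg_of_neg_pi_div_two_le_of_le (by linarith) hV2
      -- The crossing is transversal: at `U = π/2` the speed is `cos V + ε a > 0`.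
      refine ⟨_, ?_, (hs.hasDerivAt_U t).sub_const _⟩
      rw [sub_eq_zero.1 hut, Real.sin_pi_div_two]
      nlinarith [(hs.le_a_of_mem hε hT ht).2])
    -- Starting at `∓1/4` and moving by at most `1/4`, `w` keeps its weak sign at each end of the
    -- family.
    (fun t ht => by
      have := (h _ ⟨le_rfl, by norm_num⟩).abs_sub_w_le hε hT ht
      rw [hw0] at this
      linarith [(abs_le.1 this).2])
    (fun t ht => by
      have := (h _ ⟨by norm_num, le_rfl⟩).abs_sub_w_le hε hT ht
      rw [hw0] at this
      linarith [(abs_le.1 this).1])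
  exact ⟨p, t, ht, sub_eq_zero.1 h1, h2⟩

/-- In a family of saddle passages whose initial deviation sweeps `[-1/4, 1/4]`, some member
reaches the diagonal `U = V` with zero deviation. -/
theorem SaddlePassage.exists_U_eq_V {ε T : ℝ} {a b U V w : ℝ → ℝ → ℝ}
    (h : ∀ p ∈ Set.Icc (-(1 / 4) : ℝ) (1 / 4), SaddlePassage ε (a p) (b p) (U p) (V p) (w p))
    (hab : ∀ p t, |w p t| ≤ 1 / 2 → b p t < a p t)
    (hU : Continuous fun q : ℝ × ℝ => U q.1 q.2) (hV : Continuous fun q : ℝ × ℝ => V q.1 q.2)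
    (hw : Continuous fun q : ℝ × ℝ => w q.1 q.2)
    (hw0 : ∀ p, w p 0 = p) (hε : 0 < ε) (hT : 16 * ε * T ^ 2 = 1) (hT1 : 2 * Real.pi ≤ T)
    (hexp : 16 * Real.pi * T ^ 2 + 1 < Real.exp ((T - 2 * Real.pi) / 4)) :
    ∃ p, ∃ t > 0, U p t = V p t ∧ w p t = 0 := by
  have hpi := Real.pi_gt_three
  have hUp : ∀ p, Continuous (U p) := fun p =>
    hU.comp (by fun_prop : Continuous fun t : ℝ => (p, t))
  -- When `U` first reaches `π/2`, `V = U` would make `sin U * sin V = 1`, which the small first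
  -- integral excludes. So the diagonal is crossed before, inside the region where `V_bounds`
  -- applies.
  have hhit : ∀ p ∈ Set.Icc (-(1 / 4) : ℝ) (1 / 4), ∀ t ∈ Set.Icc 0 T, Real.pi / 2 ≤ U p t →
      ∃ s ∈ Set.Icc 0 t, V p s < U p s := by
    intro p hp t ht hUt
    obtain ⟨s, hs0, hst, hUs, hlt⟩ := exists_first_hitting_time (hUp p)
      (by rw [(h p hp).U_zero]; linarith) ht.1 hUt
    have hsT : s ∈ Set.Icc 0 T := ⟨hs0.le, hst.trans ht.2⟩
    obtain ⟨-, hV2, -⟩ := (h p hp).V_bounds hε hT (by linarith) hsT.2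
      (fun r hr => by
        rcases hr.2.eq_or_lt with h | h
        · rw [h, hUs]
        · exact (hlt r hr.1 h).le) s ⟨hs0.le, le_rfl⟩
    refine ⟨s, ⟨hs0.le, hst⟩, hUs ▸ hV2.lt_of_ne fun hVs => ?_⟩
    have := (h p hp).abs_sin_mul_sin_le hε hs0.le
    rw [hUs, hVs, Real.sin_pi_div_two] at this
    norm_num at this
    nlinarith [hsT.2, mul_pos hε (by linarith : 0 < T)]
  obtain ⟨p, t, ht, h1, h2⟩ := exists_common_zero_of_crossing (a := -(1 / 4)) (b := 1 / 4) (T := T)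
    (u := fun p t => U p t - V p t) (g := w) (by norm_num) (by fun_prop) hw
    (fun p hp => by rw [(h p hp).U_zero, (h p hp).V_zero]; linarith)
    (fun p hp => by
      obtain ⟨t, ht, hUt⟩ := (h p hp).exists_pi_div_two_le_U hε hT hT1 hexp
      obtain ⟨s, hs, hVU⟩ := hhit p hp t ht hUt
      exact ⟨s, ⟨hs.1, hs.2.trans ht.2⟩, by linarith⟩)
    (fun p hp t ht hut hle => by
      have hs := h p hp
      have hUle : ∀ s ∈ Set.Icc 0 t, U p s ≤ Real.pi / 2 := by
        intro s hst
        by_contra! hlt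
        obtain ⟨r, hr, hVU⟩ := hhit p hp s ⟨hst.1, hst.2.trans ht.2⟩ hlt.le
        linarith [hle r ⟨hr.1, hr.2.trans hst.2⟩]
      have hU0 := hs.U_nonneg hε hT ht
      have hU1 := hUle t ⟨ht.1, le_rfl⟩
      -- On the diagonal `U' - V' = 2 sin U cos U + ε (a - b)`, which is positive because `b < a`.
      refine ⟨_, ?_, (hs.hasDerivAt_U t).sub (hs.hasDerivAt_V t)⟩
      rw [← sub_eq_zero.1 hut]
      have hsin := Real.sin_nonneg_of_nonneg_of_le_pi hU0 (by linarith)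
      have hcos := Real.cos_nonneg_of_neg_pi_div_two_le_of_le (by linarith) hU1
      nlinarith [mul_nonneg hsin hcos,
        mul_pos hε (sub_pos.2 (hab p t (hs.le_a_of_mem hε hT ht).1))])
    (fun t ht => by
      have := (h _ ⟨le_rfl, by norm_num⟩).abs_sub_w_le hε hT ht
      rw [hw0] at this
      linarith [(abs_le.1 this).2])
    (fun t ht => by
      have := (h _ ⟨by norm_num, le_rfl⟩).abs_sub_w_le hε hT ht
      rw [hw0] at this
      linarith [(abs_le.1 this).1])
  exact ⟨p, t, ht, sub_eq_zero.1 h1, h2⟩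

/-! ### Bounds and uniqueness for the ABC field. -/

theorem lipschitzWith_abcField {ε : ℝ} (h0 : 0 ≤ ε) (h1 : ε ≤ 1) :
    LipschitzWith 2 (abcField ε 1 1) := by
  refine LipschitzWith.of_dist_le_mul fun p q => ?_
  have hc : ∀ i, |p i - q i| ≤ dist p q := fun i => dist_le_pi_dist p q i
  have hs : ∀ i, |Real.sin (p i) - Real.sin (q i)| ≤ dist p q := fun i =>
    (Real.abs_sin_sub_sin_le _ _).trans (hc i)
  have hk : ∀ i, |Real.cos (p i) - Real.cos (q i)| ≤ dist p q := fun i =>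
    (Real.abs_cos_sub_cos_le _ _).trans (hc i)
  have hd : 0 ≤ dist p q := dist_nonneg
  have s0 := abs_le.1 (hs 0)
  have s1 := abs_le.1 (hs 1)
  have s2 := abs_le.1 (hs 2)
  have k0 := abs_le.1 (hk 0)
  have k1 := abs_le.1 (hk 1)
  have k2 := abs_le.1 (hk 2)
  refine (dist_pi_le_iff (by positivity)).2 fun i => ?_
  rw [Real.dist_eq, abs_le]
  fin_cases i <;> simp [abcField] <;> constructor <;> nlinarith

theorem norm_abcField_le {ε : ℝ} (h0 : 0 ≤ ε) (h1 : ε ≤ 1) (p : Fin 3 → ℝ) :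
    ‖abcField ε 1 1 p‖ ≤ 2 := by
  refine (pi_norm_le_iff_of_nonneg two_pos.le).2 fun i => ?_
  have s0 := abs_le.1 (Real.abs_sin_le_one (p 0))
  have s1 := abs_le.1 (Real.abs_sin_le_one (p 1))
  have s2 := abs_le.1 (Real.abs_sin_le_one (p 2))
  have k0 := abs_le.1 (Real.abs_cos_le_one (p 0))
  have k1 := abs_le.1 (Real.abs_cos_le_one (p 1))
  have k2 := abs_le.1 (Real.abs_cos_le_one (p 2))
  rw [Real.norm_eq_abs, abs_le]
  fin_cases i <;> simp [abcField] <;> constructor <;> nlinarith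

theorem IsABCTrajectory.eq_of_eq {ε : ℝ} (h0 : 0 ≤ ε) (h1 : ε ≤ 1) {X Y : ℝ → Fin 3 → ℝ}
    (hX : IsABCTrajectory ε 1 1 X) (hY : IsABCTrajectory ε 1 1 Y) {t : ℝ} (h : X t = Y t) :
    X = Y :=
  ODE_solution_unique_univ (v := fun _ => abcField ε 1 1) (s := fun _ => Set.univ)
    (fun _ => (lipschitzWith_abcField h0 h1).lipschitzOnWith) (fun t => ⟨hX t, trivial⟩)
    (fun t => ⟨hY t, trivial⟩) h

theorem isABCTrajectory_iff {A B C : ℝ} {X : ℝ → Fin 3 → ℝ} :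
    IsABCTrajectory A B C X ↔
      (∀ t, HasDerivAt (fun s => X s 0) (A * Real.sin (X t 2) + C * Real.cos (X t 1)) t) ∧
      (∀ t, HasDerivAt (fun s => X s 1) (B * Real.sin (X t 0) + A * Real.cos (X t 2)) t) ∧
      (∀ t, HasDerivAt (fun s => X s 2) (C * Real.sin (X t 1) + B * Real.cos (X t 0)) t) := by
  simp only [IsABCTrajectory, hasDerivAt_pi, Fin.forall_fin_succ, abcField, ← forall_and]
  simp

/-! ### Time-reversing and time-preserving symmetries. -/

section Symmetries

variable {ε : ℝ} {X : ℝ → Fin 3 → ℝ}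

theorem HasDerivAt.comp_const_sub_real {f : ℝ → ℝ} {f' c t : ℝ} (h : HasDerivAt f f' (c - t)) :
    HasDerivAt (fun s => f (c - s)) (-f') t := by
  simpa [Function.comp_def] using h.comp t ((hasDerivAt_id t).const_sub c)

/-- Rotation by a half turn about a vertical line reverses the flow. -/
theorem IsABCTrajectory.halfTurn (hX : IsABCTrajectory ε 1 1 X) {c α β : ℝ}
    (hα : ∀ x, Real.sin (α - x) = Real.sin x ∧ Real.cos (α - x) = -Real.cos x)
    (hβ : ∀ x, Real.sin (β - x) = -Real.sin x ∧ Real.cos (β - x) = Real.cos x) :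
    IsABCTrajectory ε 1 1
      fun t => ![α - X (c - t) 0, β - X (c - t) 1, X (c - t) 2] := by
  obtain ⟨hx, hy, hz⟩ := isABCTrajectory_iff.1 hX
  refine isABCTrajectory_iff.2 ⟨fun t => ?_, fun t => ?_, fun t => ?_⟩
  · exact ((hx (c - t)).comp_const_sub_real.const_sub α).congr_deriv (by simp [hβ])
  · exact ((hy (c - t)).comp_const_sub_real.const_sub β).congr_deriv (by simp [hα])
  · exact ((hz (c - t)).comp_const_sub_real).congr_deriv (by simp [hα, hβ]; ring)

/-- The time-reversing reflection in a plane `x = π` and a level `z = π / 2`. -/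
theorem IsABCTrajectory.reflect (hX : IsABCTrajectory ε 1 1 X) (c : ℝ) :
    IsABCTrajectory ε 1 1
      fun t => ![2 * Real.pi - X (c - t) 0, X (c - t) 1, Real.pi - X (c - t) 2] := by
  obtain ⟨hx, hy, hz⟩ := isABCTrajectory_iff.1 hX
  refine isABCTrajectory_iff.2 ⟨fun t => ?_, fun t => ?_, fun t => ?_⟩
  · exact ((hx (c - t)).comp_const_sub_real.const_sub _).congr_deriv (by simp)
  · exact ((hy (c - t)).comp_const_sub_real).congr_deriv (by simp; ring)
  · exact ((hz (c - t)).comp_const_sub_real.const_sub _).congr_deriv (by simp)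

theorem Real.sin_five_pi_div_two_sub (x : ℝ) : Real.sin (5 * Real.pi / 2 - x) = Real.cos x := by
  rw [show 5 * Real.pi / 2 - x = Real.pi / 2 - x + 2 * Real.pi by ring, Real.sin_add_two_pi,
    Real.sin_pi_div_two_sub]

theorem Real.cos_five_pi_div_two_sub (x : ℝ) : Real.cos (5 * Real.pi / 2 - x) = Real.sin x := by
  rw [show 5 * Real.pi / 2 - x = Real.pi / 2 - x + 2 * Real.pi by ring, Real.cos_add_two_pi,
    Real.cos_pi_div_two_sub]

/-- The time-reversing reflection that exchanges `x` and `y`. -/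
theorem IsABCTrajectory.swapReflect (hX : IsABCTrajectory ε 1 1 X) (c : ℝ) :
    IsABCTrajectory ε 1 1 fun t => ![5 * Real.pi / 2 - X (c - t) 1,
      5 * Real.pi / 2 - X (c - t) 0, Real.pi / 2 - X (c - t) 2] := by
  obtain ⟨hx, hy, hz⟩ := isABCTrajectory_iff.1 hX
  refine isABCTrajectory_iff.2 ⟨fun t => ?_, fun t => ?_, fun t => ?_⟩
  · refine ((hy (c - t)).comp_const_sub_real.const_sub _).congr_deriv ?_
    simp [Real.cos_five_pi_div_two_sub, Real.sin_pi_div_two_sub]; ring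
  · refine ((hx (c - t)).comp_const_sub_real.const_sub _).congr_deriv ?_
    simp [Real.sin_five_pi_div_two_sub, Real.cos_pi_div_two_sub]; ring
  · refine ((hz (c - t)).comp_const_sub_real.const_sub _).congr_deriv ?_
    simp [Real.sin_five_pi_div_two_sub, Real.cos_five_pi_div_two_sub]; ring

/-- Reverses the drift in both `x` and `y`; `screw_yz` reverses only the drift in `y`. -/
theorem IsABCTrajectory.screw_xy (hX : IsABCTrajectory ε 1 1 X) :
    IsABCTrajectory ε 1 1 fun t => ![-X t 0, Real.pi - X t 1, Real.pi + X t 2] := by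
  obtain ⟨hx, hy, hz⟩ := isABCTrajectory_iff.1 hX
  refine isABCTrajectory_iff.2 ⟨fun t => ?_, fun t => ?_, fun t => ?_⟩
  · refine (hx t).neg.congr_deriv ?_
    simp [add_comm Real.pi]; ring
  · refine ((hy t).const_sub _).congr_deriv ?_
    simp [add_comm Real.pi]; ring
  · exact ((hz t).const_add _).congr_deriv (by simp)

theorem IsABCTrajectory.screw_yz (hX : IsABCTrajectory ε 1 1 X) :
    IsABCTrajectory ε 1 1 fun t => ![X t 0 - Real.pi, -X t 1, Real.pi - X t 2] := by
  obtain ⟨hx, hy, hz⟩ := isABCTrajectory_iff.1 hX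
  refine isABCTrajectory_iff.2 ⟨fun t => ?_, fun t => ?_, fun t => ?_⟩
  · exact ((hx t).sub_const _).congr_deriv (by simp)
  · refine (hy t).neg.congr_deriv ?_
    simp; ring
  · refine ((hz t).const_sub _).congr_deriv ?_
    simp; ring

theorem IsABCTrajectory.swap (hX : IsABCTrajectory ε 1 1 X) :
    IsABCTrajectory ε 1 1
      fun t => ![X t 1 + Real.pi / 2, X t 0 - Real.pi / 2, Real.pi / 2 - X t 2] := by
  obtain ⟨hx, hy, hz⟩ := isABCTrajectory_iff.1 hX
  refine isABCTrajectory_iff.2 ⟨fun t => ?_, fun t => ?_, fun t => ?_⟩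
  · refine ((hy t).add_const _).congr_deriv ?_
    simp [Real.cos_sub_pi_div_two, Real.sin_pi_div_two_sub]; ring
  · refine ((hx t).sub_const _).congr_deriv ?_
    simp [Real.sin_add_pi_div_two, Real.cos_pi_div_two_sub]; ring
  · refine ((hz t).const_sub _).congr_deriv ?_
    simp [Real.sin_sub_pi_div_two, Real.cos_add_pi_div_two]

end Symmetries

/-! ### From two reversing symmetries to drift. -/

/-- A trajectory joining the axes of a half turn and of a reflection drifts along `x`. -/
theorem IsABCTrajectory.drift_x {ε τ : ℝ} (h0 : 0 ≤ ε) (h1 : ε ≤ 1) {X : ℝ → Fin 3 → ℝ}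
    (hX : IsABCTrajectory ε 1 1 X) (hx0 : X 0 0 = Real.pi / 2) (hy0 : X 0 1 = 0)
    (hxτ : X τ 0 = Real.pi) (hzτ : X τ 2 = Real.pi / 2) (t : ℝ) :
    X (t + 4 * τ) = X t + ![2 * Real.pi, 0, 0] := by
  have hA := hX.eq_of_eq h0 h1 (hX.halfTurn (c := 0) (α := Real.pi) (β := 0)
    (fun x => by simp) (fun x => by simp)) (t := 0)
    (by ext i; fin_cases i <;> simp [hx0, hy0]; ring)
  have hB := hX.eq_of_eq h0 h1 (hX.reflect (2 * τ)) (t := τ)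
    (by
      have : 2 * τ - τ = τ := by ring
      ext i; fin_cases i <;> simp [hxτ, hzτ, this] <;> ring)
  -- `hA` and `hB` say that `X` is its own image under each reversal, since it meets both fixed
  -- lines. Their composite is a time shift by `2 * τ`, and applying it twice leaves a pure
  -- translation.
  have hstep : ∀ s, X (s + 2 * τ) = ![X s 0 + Real.pi, -X s 1, Real.pi - X s 2] := by
    intro s
    have h1 := congrFun hB (s + 2 * τ)
    have h2 := congrFun hA (-s)
    simp only [zero_sub, neg_neg, show 2 * τ - (s + 2 * τ) = -s by ring] at h1 h2
    rw [h1, h2]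
    ext i; fin_cases i <;> simp; ring
  rw [show t + 4 * τ = t + 2 * τ + 2 * τ by ring, hstep, hstep]
  ext i; fin_cases i <;> simp; ring

/-- A trajectory joining the axes of a half turn and of a swapping reflection drifts along the
diagonal. -/
theorem IsABCTrajectory.drift_diagonal {ε τ : ℝ} (h0 : 0 ≤ ε) (h1 : ε ≤ 1) {X : ℝ → Fin 3 → ℝ}
    (hX : IsABCTrajectory ε 1 1 X) (hx0 : X 0 0 = Real.pi / 2) (hy0 : X 0 1 = Real.pi)
    (hxyτ : X τ 0 + X τ 1 = 5 * Real.pi / 2) (hzτ : X τ 2 = Real.pi / 4) (t : ℝ) :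
    X (t + 4 * τ) = X t + ![2 * Real.pi, 2 * Real.pi, 0] := by
  have hA := hX.eq_of_eq h0 h1 (hX.halfTurn (c := 0) (α := Real.pi) (β := 2 * Real.pi)
    (fun x => by simp) (fun x => by simp)) (t := 0)
    (by ext i; fin_cases i <;> simp [hx0, hy0] <;> ring)
  have hB := hX.eq_of_eq h0 h1 (hX.swapReflect (2 * τ)) (t := τ)
    (by
      have : 2 * τ - τ = τ := by ring
      ext i; fin_cases i <;> simp [hzτ, this] <;> linarith)
  have hstep : ∀ s, X (s + 2 * τ) =
      ![X s 1 + Real.pi / 2, X s 0 + 3 * Real.pi / 2, Real.pi / 2 - X s 2] := by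
    intro s
    have h1 := congrFun hB (s + 2 * τ)
    have h2 := congrFun hA (-s)
    simp only [zero_sub, neg_neg, show 2 * τ - (s + 2 * τ) = -s by ring] at h1 h2
    rw [h1, h2]
    ext i; fin_cases i <;> simp <;> ring
  rw [show t + 4 * τ = t + 2 * τ + 2 * τ by ring, hstep, hstep]
  ext i; fin_cases i <;> simp <;> ring

/-! ### ABC trajectories as saddle passages. -/

theorem Real.cos_add_sin_ge_of_abs_le {w : ℝ} (hw : |w| ≤ 1 / 2) :
    1 / 4 ≤ Real.cos w + Real.sin w ∧ 1 / 4 ≤ Real.cos w := by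
  have h1 := Real.one_sub_sq_div_two_le_cos (x := w)
  have h2 := (abs_le.1 (Real.abs_sin_le_abs (x := w))).1
  have h3 : w ^ 2 ≤ 1 / 4 := by
    rw [← sq_abs]
    nlinarith [abs_nonneg w]
  constructor <;> linarith

theorem abs_sqrt_two_div_two_mul_le {x : ℝ} (hx : |x| ≤ 1) : |√2 / 2 * x| ≤ 1 := by
  have hs : √2 ≤ 2 := Real.sqrt_le_iff.2 ⟨by norm_num, by norm_num⟩
  rw [abs_mul, abs_of_nonneg (by positivity)]
  nlinarith [abs_nonneg x, Real.sqrt_nonneg 2]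

/-- Trajectories through the axis `x = π / 2, y = π` near the level `z = π / 4` pass the saddle
`(0, 3π / 2)`. -/
theorem IsABCTrajectory.saddlePassage_diagonal {ε p : ℝ} {X : ℝ → Fin 3 → ℝ}
    (hX : IsABCTrajectory ε 1 1 X) (hX0 : X 0 = ![Real.pi / 2, Real.pi, Real.pi / 4 + p])
    (hp : |p| ≤ 1 / 4) :
    SaddlePassage ε (fun t => √2 / 2 * Real.cos (X t 2 - Real.pi / 4))
      (fun t => √2 / 2 * Real.sin (X t 2 - Real.pi / 4))
      (fun t => (X t 0 + X t 1 - 3 * Real.pi / 2) / 2)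
      (fun t => (X t 0 - X t 1 + 3 * Real.pi / 2) / 2)
      (fun t => X t 2 - Real.pi / 4) := by
  obtain ⟨hx, hy, hz⟩ := isABCTrajectory_iff.1 hX
  have hq : √2 * √2 = 2 := Real.mul_self_sqrt (by norm_num)
  have hsinx : ∀ t, Real.sin (X t 0) = Real.sin ((X t 0 + X t 1 - 3 * Real.pi / 2) / 2 +
      (X t 0 - X t 1 + 3 * Real.pi / 2) / 2) := fun t => by congr 1; ring
  have hcosx : ∀ t, Real.cos (X t 0) = Real.cos ((X t 0 + X t 1 - 3 * Real.pi / 2) / 2 +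
      (X t 0 - X t 1 + 3 * Real.pi / 2) / 2) := fun t => by congr 1; ring
  have hy' : ∀ t, X t 1 = (X t 0 + X t 1 - 3 * Real.pi / 2) / 2 -
      (X t 0 - X t 1 + 3 * Real.pi / 2) / 2 - Real.pi / 2 + 2 * Real.pi := fun t => by ring
  have hcosy : ∀ t, Real.cos (X t 1) = Real.sin ((X t 0 + X t 1 - 3 * Real.pi / 2) / 2 -
      (X t 0 - X t 1 + 3 * Real.pi / 2) / 2) := fun t => by
    conv_lhs => rw [hy' t]
    rw [Real.cos_add_two_pi, Real.cos_sub_pi_div_two]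
  have hsiny : ∀ t, Real.sin (X t 1) = -Real.cos ((X t 0 + X t 1 - 3 * Real.pi / 2) / 2 -
      (X t 0 - X t 1 + 3 * Real.pi / 2) / 2) := fun t => by
    conv_lhs => rw [hy' t]
    rw [Real.sin_add_two_pi, Real.sin_sub_pi_div_two]
  refine
    { hasDerivAt_U := fun t =>
        ((((hx t).add (hy t)).sub_const (3 * Real.pi / 2)).div_const 2).congr_deriv ?_
      hasDerivAt_V := fun t =>
        ((((hx t).sub (hy t)).add_const (3 * Real.pi / 2)).div_const 2).congr_deriv ?_
      hasDerivAt_w := fun t => ((hz t).sub_const _).congr_deriv ?_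
      U_zero := by simp [hX0]; ring
      V_zero := by simp [hX0]; ring
      abs_a_le := fun t => abs_sqrt_two_div_two_mul_le (Real.abs_cos_le_one _)
      abs_b_le := fun t => abs_sqrt_two_div_two_mul_le (Real.abs_sin_le_one _)
      abs_w_zero_le := by simpa [hX0] using hp
      le_a := fun t ht => ?_ }
  -- The forcing of `U` is `ε (sin z + cos z)/2`, that is `ε (√2/2) cos (z - π/4)`: it is strongest
  -- at `z = π/4`, the level of the fixed line.
  · rw [hsinx, hcosy, Real.sin_add, Real.sin_sub, Real.cos_sub (X t 2), Real.cos_pi_div_four,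
      Real.sin_pi_div_four]
    linear_combination -(ε * (Real.cos (X t 2) + Real.sin (X t 2)) / 4) * hq
  · rw [hsinx, hcosy, Real.sin_add, Real.sin_sub, Real.sin_sub (X t 2), Real.cos_pi_div_four,
      Real.sin_pi_div_four]
    linear_combination -(ε * (Real.sin (X t 2) - Real.cos (X t 2)) / 4) * hq
  · rw [hcosx, hsiny, Real.cos_add, Real.cos_sub]
    ring
  · have h1 := (Real.cos_add_sin_ge_of_abs_le ht).2
    have h2 : 1 ≤ √2 := Real.one_le_sqrt.2 (by norm_num)
    nlinarith

/-- Trajectories through the axis `x = π / 2, y = 0` near the level `z = π / 2` pass the saddle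
`(π, π / 2)`. -/
theorem IsABCTrajectory.saddlePassage_axis {ε p : ℝ} {X : ℝ → Fin 3 → ℝ}
    (hX : IsABCTrajectory ε 1 1 X) (hX0 : X 0 = ![Real.pi / 2, 0, Real.pi / 2 + p])
    (hp : |p| ≤ 1 / 4) :
    SaddlePassage ε
      (fun t => (Real.cos (X t 2 - Real.pi / 2) + Real.sin (X t 2 - Real.pi / 2)) / 2)
      (fun t => (Real.sin (X t 2 - Real.pi / 2) - Real.cos (X t 2 - Real.pi / 2)) / 2)
      (fun t => (X t 0 - X t 1 - Real.pi / 2) / 2)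
      (fun t => (3 * Real.pi / 2 - X t 0 - X t 1) / 2)
      (fun t => X t 2 - Real.pi / 2) := by
  obtain ⟨hx, hy, hz⟩ := isABCTrajectory_iff.1 hX
  have hx' : ∀ t, X t 0 = Real.pi - ((3 * Real.pi / 2 - X t 0 - X t 1) / 2 -
      (X t 0 - X t 1 - Real.pi / 2) / 2) := fun t => by ring
  have hy' : ∀ t, X t 1 = Real.pi / 2 - ((X t 0 - X t 1 - Real.pi / 2) / 2 +
      (3 * Real.pi / 2 - X t 0 - X t 1) / 2) := fun t => by ring
  have hsinx : ∀ t, Real.sin (X t 0) = Real.sin ((3 * Real.pi / 2 - X t 0 - X t 1) / 2 -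
      (X t 0 - X t 1 - Real.pi / 2) / 2) := fun t => by
    conv_lhs => rw [hx' t, Real.sin_pi_sub]
  have hcosx : ∀ t, Real.cos (X t 0) = -Real.cos ((3 * Real.pi / 2 - X t 0 - X t 1) / 2 -
      (X t 0 - X t 1 - Real.pi / 2) / 2) := fun t => by
    conv_lhs => rw [hx' t, Real.cos_pi_sub]
  have hsiny : ∀ t, Real.sin (X t 1) = Real.cos ((X t 0 - X t 1 - Real.pi / 2) / 2 +
      (3 * Real.pi / 2 - X t 0 - X t 1) / 2) := fun t => by
    conv_lhs => rw [hy' t, Real.sin_pi_div_two_sub]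
  have hcosy : ∀ t, Real.cos (X t 1) = Real.sin ((X t 0 - X t 1 - Real.pi / 2) / 2 +
      (3 * Real.pi / 2 - X t 0 - X t 1) / 2) := fun t => by
    conv_lhs => rw [hy' t, Real.cos_pi_div_two_sub]
  have hs : ∀ x, |Real.sin x| ≤ 1 := Real.abs_sin_le_one
  have hc : ∀ x, |Real.cos x| ≤ 1 := Real.abs_cos_le_one
  refine
    { hasDerivAt_U := fun t =>
        ((((hx t).sub (hy t)).sub_const (Real.pi / 2)).div_const 2).congr_deriv ?_
      hasDerivAt_V := fun t =>
        ((((hx t).const_sub (3 * Real.pi / 2)).sub (hy t)).div_const 2).congr_deriv ?_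
      hasDerivAt_w := fun t => ((hz t).sub_const _).congr_deriv ?_
      U_zero := by simp [hX0]
      V_zero := by simp [hX0]; ring
      abs_a_le := fun t => ?_
      abs_b_le := fun t => ?_
      abs_w_zero_le := by simpa [hX0] using hp
      le_a := fun t ht => by linarith [(Real.cos_add_sin_ge_of_abs_le ht).1] }
  · rw [hsinx, hcosy, Real.sin_add, Real.sin_sub, Real.cos_sub_pi_div_two, Real.sin_sub_pi_div_two]
    ring
  · rw [hsinx, hcosy, Real.sin_add, Real.sin_sub, Real.cos_sub_pi_div_two, Real.sin_sub_pi_div_two]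
    ring
  · rw [hcosx, hsiny, Real.cos_add, Real.cos_sub]
    ring
  · have h1 := abs_le.1 (hs (X t 2 - Real.pi / 2))
    have h2 := abs_le.1 (hc (X t 2 - Real.pi / 2))
    exact abs_le.2 ⟨by linarith, by linarith⟩
  · have h1 := abs_le.1 (hs (X t 2 - Real.pi / 2))
    have h2 := abs_le.1 (hc (X t 2 - Real.pi / 2))
    exact abs_le.2 ⟨by linarith, by linarith⟩

/-! ### Choice of the time scale. -/

/-- For small `ε` the time scale `T = 1 / (4 √ε)` is long compared with the logarithmic passage
time at the saddle. -/
theorem exists_passage_time_scale : ∃ ε₀ : ℝ, 0 < ε₀ ∧ ε₀ ≤ 1 ∧ ∀ ε, 0 < ε → ε < ε₀ →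
    ∃ T, 16 * ε * T ^ 2 = 1 ∧ 2 * Real.pi ≤ T ∧
      16 * Real.pi * T ^ 2 + 1 < Real.exp ((T - 2 * Real.pi) / 4) := by
  have hev : ∀ᶠ x : ℝ in Filter.atTop,
      16 * Real.pi * (4 * x + 2 * Real.pi) ^ 2 + 1 < Real.exp x := by
    have h2 := Real.isLittleO_pow_exp_atTop (n := 2)
    have h1 := Real.isLittleO_pow_exp_atTop (n := 1)
    have h0 := Real.isLittleO_pow_exp_atTop (n := 0)
    -- These are the coefficients of `16 π (4x + 2π)² + 1` expanded in powers of `x`, where `x = (T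
    -- - 2π)/4`.
    have h := ((h2.const_mul_left (256 * Real.pi)).add (h1.const_mul_left
      (256 * Real.pi ^ 2))).add (h0.const_mul_left (64 * Real.pi ^ 3 + 1))
    filter_upwards [h.def (by norm_num : (0 : ℝ) < 1 / 2)] with x hx
    rw [Real.norm_eq_abs, Real.norm_eq_abs, abs_of_pos (Real.exp_pos x)] at hx
    have := (le_abs_self _).trans hx
    nlinarith [Real.exp_pos x]
  obtain ⟨x₀, hx₀⟩ := Filter.eventually_atTop.1 hev
  set T₀ := max 1 (max (2 * Real.pi) (4 * x₀ + 2 * Real.pi)) with hT₀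
  have hT₀1 : 1 ≤ T₀ := le_max_left _ _
  refine ⟨1 / (16 * T₀ ^ 2), by positivity, ?_, fun ε hε hlt => ⟨1 / (4 * √ε), ?_, ?_⟩⟩
  · rw [div_le_one (by positivity)]
    nlinarith
  · rw [div_pow, mul_pow, Real.sq_sqrt hε.le]
    field_simp
    norm_num
  · have hT : T₀ ≤ 1 / (4 * √ε) := by
      rw [le_div_iff₀ (by positivity)]
      have h1 : ε * (16 * T₀ ^ 2) < 1 := (lt_div_iff₀ (by positivity)).1 hlt
      have h2 : (T₀ * (4 * √ε)) ^ 2 < 1 := by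
        rw [mul_pow, mul_pow, Real.sq_sqrt hε.le]
        linarith
      exact ((sq_lt_one_iff₀ (by positivity)).1 h2).le
    have hT1 := ((le_max_left _ _).trans (le_max_right 1 _)).trans hT
    have hT2 := ((le_max_right _ _).trans (le_max_right 1 _)).trans hT
    refine ⟨hT1, ?_⟩
    have := hx₀ ((1 / (4 * √ε) - 2 * Real.pi) / 4) (by linarith)
    convert this using 4
    ring

/-! ### Assembly of the drifting trajectories. -/

theorem theorem3p1 :
    ∃ ε₀ : ℝ, 0 < ε₀ ∧ ∀ ε : ℝ, 0 < ε → ε < ε₀ →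
      (∃ T : ℝ, 0 < T ∧ ∃ X₁ X₂ X₃ X₄ : ℝ → Fin 3 → ℝ,
        (IsABCTrajectory ε 1 1 X₁ ∧
          ∀ t, X₁ (t + T) = X₁ t + ![2 * Real.pi, 2 * Real.pi, 0]) ∧
        (IsABCTrajectory ε 1 1 X₂ ∧
          ∀ t, X₂ (t + T) = X₂ t - ![2 * Real.pi, 2 * Real.pi, 0]) ∧
        (IsABCTrajectory ε 1 1 X₃ ∧
          ∀ t, X₃ (t + T) = X₃ t + ![2 * Real.pi, -(2 * Real.pi), 0]) ∧
        (IsABCTrajectory ε 1 1 X₄ ∧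
          ∀ t, X₄ (t + T) = X₄ t - ![2 * Real.pi, -(2 * Real.pi), 0])) ∧
      (∃ T : ℝ, 0 < T ∧ ∃ X₁ X₂ X₃ X₄ : ℝ → Fin 3 → ℝ,
        (IsABCTrajectory ε 1 1 X₁ ∧
          ∀ t, X₁ (t + T) = X₁ t + ![2 * Real.pi, 0, 0]) ∧
        (IsABCTrajectory ε 1 1 X₂ ∧
          ∀ t, X₂ (t + T) = X₂ t - ![2 * Real.pi, 0, 0]) ∧
        (IsABCTrajectory ε 1 1 X₃ ∧
          ∀ t, X₃ (t + T) = X₃ t + ![0, 2 * Real.pi, 0]) ∧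
        (IsABCTrajectory ε 1 1 X₄ ∧
          ∀ t, X₄ (t + T) = X₄ t - ![0, 2 * Real.pi, 0])) := by
  obtain ⟨ε₀, hε₀, hε₀1, hscale⟩ := exists_passage_time_scale
  refine ⟨ε₀, hε₀, fun ε hε hlt => ?_⟩
  obtain ⟨T, hT, hT1, hexp⟩ := hscale ε hε hlt
  have hε1 : ε ≤ 1 := hlt.le.trans hε₀1
  obtain ⟨Φ, hΦ0, hΦ, hΦc⟩ := exists_continuous_flow (L := 2) (lipschitzWith_abcField hε.le hε1)
    (norm_abcField_le hε.le hε1)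
  have hcoord : ∀ c : ℝ → Fin 3 → ℝ, Continuous c → ∀ i,
      Continuous fun q : ℝ × ℝ => Φ (c q.1) q.2 i := fun c hc i =>
    (continuous_apply i).comp (hΦc.comp ((hc.comp continuous_fst).prodMk continuous_snd))
  constructor
  · set c : ℝ → Fin 3 → ℝ := fun p => ![Real.pi / 2, Real.pi, Real.pi / 4 + p] with hc
    have hcc : Continuous c := by
      refine continuous_pi fun i => ?_
      fin_cases i <;> simp [hc] <;> fun_prop
    have h0 := hcoord c hcc 0
    have h1 := hcoord c hcc 1
    have h2 := hcoord c hcc 2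
    obtain ⟨p, τ, hτ, hUτ, hwτ⟩ := SaddlePassage.exists_U_eq_pi_div_two
      (fun p hp => IsABCTrajectory.saddlePassage_diagonal (hΦ (c p)) (hΦ0 (c p)) (abs_le.2 hp))
      (by fun_prop) (by fun_prop) (fun p => by simp [hΦ0, hc]) hε hT hT1 hexp
    have htraj : IsABCTrajectory ε 1 1 (Φ (c p)) := hΦ (c p)
    -- `U = π/2` and `w = 0` mean `x + y = 5π/2` and `z = π/4`, the fixed line of `swapReflect`.
    have hdrift := htraj.drift_diagonal hε.le hε1 (τ := τ) (by simp [hΦ0, hc])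
      (by simp [hΦ0, hc]) (by linarith) (by linarith)
    refine ⟨4 * τ, by positivity, _, _, _, _, ⟨htraj, hdrift⟩, ⟨htraj.screw_xy, fun t => ?_⟩,
      ⟨htraj.screw_yz, fun t => ?_⟩, ⟨htraj.screw_yz.screw_xy, fun t => ?_⟩⟩ <;>
    · rw [hdrift]
      ext i
      fin_cases i <;> simp <;> ring
  · set c : ℝ → Fin 3 → ℝ := fun p => ![Real.pi / 2, 0, Real.pi / 2 + p] with hc
    have hcc : Continuous c := by
      refine continuous_pi fun i => ?_
      fin_cases i <;> simp [hc] <;> fun_prop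
    have h0 := hcoord c hcc 0
    have h1 := hcoord c hcc 1
    have h2 := hcoord c hcc 2
    obtain ⟨p, τ, hτ, hUτ, hwτ⟩ := SaddlePassage.exists_U_eq_V
      (fun p hp => IsABCTrajectory.saddlePassage_axis (hΦ (c p)) (hΦ0 (c p)) (abs_le.2 hp))
      -- Here `a - b = cos w`.
      (fun p t ht => by linarith [(Real.cos_add_sin_ge_of_abs_le ht).2])
      (by fun_prop) (by fun_prop) (by fun_prop) (fun p => by simp [hΦ0, hc]) hε hT hT1 hexp
    have htraj : IsABCTrajectory ε 1 1 (Φ (c p)) := hΦ (c p)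
    -- `U = V` and `w = 0` mean `x = π` and `z = π/2`, the fixed line of `reflect`.
    have hdrift := htraj.drift_x hε.le hε1 (τ := τ) (by simp [hΦ0, hc])
      (by simp [hΦ0, hc]) (by linarith) (by linarith)
    refine ⟨4 * τ, by positivity, _, _, _, _, ⟨htraj, hdrift⟩, ⟨htraj.screw_xy, fun t => ?_⟩,
      ⟨htraj.swap, fun t => ?_⟩, ⟨htraj.screw_xy.swap, fun t => ?_⟩⟩ <;>
    · rw [hdrift]
      ext i
      fin_cases i <;> simp; ring
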